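/- Let $H$ be a complex Hilbert space with inner product $(\cdot,\cdot)$ linear in the first argument, let $\mathcal L$ be a (possibly unbounded, densely defined) linear operator on $H$ with domain $D(\mathcal L)$ that is skew-adjoint, i.e. $\mathcal L^\dagger=-\mathcal L$ including equality of domains, and let $z\in D(\mathcal L)$ with $z\neq 0$. Put $\mathcal P x:=(x,z)(z,z)^{-1}z$ and $\mathcal Q:=1-\mathcal P$. Products of operators carry their natural domains: $D(\mathcal{QL})=D(\mathcal L)$ and, for an operator $\mathcal T$, $D(\mathcal{TQ})=\{x\in H:\mathcal Qx\in D(\mathcal T)\}$. Then $\mathcal{QL}$ is closable and, with $\overline{\mathcal{QL}}$ its closure, $\overline{\mathcal{QL}}\mathcal Q=\mathcal{QLQ}$ (with equal domains). This operator is skew-adjoint and generates a strongly continuous unitary group: there is a family $\{\mathcal G(t)\}_{t\in\mathbb R}$ of unitary operators on $H$ with $\mathcal G(0)=1$, $\mathcal G(s+t)=\mathcal G(s)\mathcal G(t)$ for all $s,t\in\mathbb R$, and $t\mapsto\mathcal G(t)x$ continuous for every $x\in H$, such that $\overline{\mathcal{QL}}\mathcal Q$ is its generator, i.e. $D(\overline{\mathcal{QL}}\mathcal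 Q)$ is the set of all $x\in H$ for which $\lim_{h\to0}\frac1h[\mathcal G(h)x-x]$ exists, and $\overline{\mathcal{QL}}\mathcal Qx$ equals this limit. -/

import Mathlib

open Filter Topology

namespace Mori

/-- A partially defined operator `T` on a Hilbert space is skew-adjoint if it is densely defined
and `T† = -T`, as an equality of partially defined operators (including the domains). -/
def IsSkewAdjoint {H : Type*} [NormedAddCommGroup H] [InnerProductSpace ℂ H] [CompleteSpace H]
    (T : H →ₗ.[ℂ] H) : Prop :=
  Dense (T.domain : Set H) ∧ T.adjoint = -T

/-- The Mori projection `P x = (x, z) (z, z)⁻¹ z`, where `(x, y)` is linear in `x`, so that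
`(x, z) = inner ℂ z x` in Mathlib's convention. -/
noncomputable def projP {H : Type*} [NormedAddCommGroup H] [InnerProductSpace ℂ H]
    (z : H) : H →L[ℂ] H :=
  (inner ℂ z z)⁻¹ • (innerSL ℂ z).smulRight z

/-- The complementary projection `Q = 1 - P`. -/
noncomputable def projQ {H : Type*} [NormedAddCommGroup H] [InnerProductSpace ℂ H]
    (z : H) : H →L[ℂ] H :=
  1 - projP z

/-- The product `B T` of an everywhere defined bounded operator `B` and a partially defined
operator `T`, with domain `D(T)`. -/
def leftMul {H : Type*} [NormedAddCommGroup H] [InnerProductSpace ℂ H]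
    (B : H →L[ℂ] H) (T : H →ₗ.[ℂ] H) : H →ₗ.[ℂ] H where
  domain := T.domain
  toFun := (B : H →ₗ[ℂ] H).comp T.toFun

/-- The product `T B` of a partially defined operator `T` and an everywhere defined bounded
operator `B`, with domain `{x | B x ∈ D(T)}`. -/
def rightMul {H : Type*} [NormedAddCommGroup H] [InnerProductSpace ℂ H]
    (T : H →ₗ.[ℂ] H) (B : H →L[ℂ] H) : H →ₗ.[ℂ] H where
  domain := T.domain.comap (B : H →ₗ[ℂ] H)
  toFun :=
    { toFun := fun x => T ⟨B x, x.2⟩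
      map_add' := fun x y => by
        rw [← T.map_add]
        congr 1
        exact Subtype.ext (map_add B (x : H) (y : H))
      map_smul' := fun c x => by
        rw [RingHom.id_apply, ← T.map_smul]
        congr 1
        exact Subtype.ext (map_smul B c (x : H)) }

/-- A strongly continuous one-parameter unitary group `(G t)`, `t ∈ ℝ`. -/
structure IsUnitaryGroup {H : Type*} [NormedAddCommGroup H] [InnerProductSpace ℂ H]
    [CompleteSpace H] (G : ℝ → H →L[ℂ] H) : Prop where
  map_zero : G 0 = 1
  map_add : ∀ s t : ℝ, G (s + t) = G s * G t
  continuous_orbit : ∀ x : H, Continuous fun t : ℝ => G t x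
  mem_unitary : ∀ t : ℝ, G t ∈ unitary (H →L[ℂ] H)

/-- `A` is the generator of the group `G`: the domain of `A` is the set of all `x` for which
`lim_{h → 0} h⁻¹ (G h x - x)` exists, and `A x` is this limit. -/
def IsGenerator {H : Type*} [NormedAddCommGroup H] [InnerProductSpace ℂ H]
    (A : H →ₗ.[ℂ] H) (G : ℝ → H →L[ℂ] H) : Prop :=
  ∀ x y : H, (x, y) ∈ A.graph ↔
    Tendsto (fun h : ℝ => (h : ℂ)⁻¹ • (G h x - x)) (𝓝[≠] 0) (𝓝 y)

end Mori

/-!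
Since `z ∈ D(L)` and `L` is skew-adjoint, `(Lx, z) = -(x, Lz)` shows that `PL` is the restriction
of a bounded operator to `D(L)`. Hence `QL = L - PL` is a bounded perturbation of the closed
operator `L`, so it is itself closed (`IsSkewAdjoint.isClosed_leftMul_projQ`): taking the closure
changes nothing, and `QLQ` is unambiguous. Because `Q` preserves and reflects membership in `D(L)`
and is symmetric, `QLQ` is skew-symmetric on `D(L)`; that it is skew-adjoint follows by testing the
adjoint relation against `D(L)` and absorbing the rank-one terms
(`IsSkewAdjoint.leftMul_rightMul_projQ`).

The unitary group comes from the generation half of Stone's theorem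
(`IsSkewAdjoint.exists_isUnitaryGroup`), proved by Yosida's method. A skew-adjoint operator `A`
satisfies `‖(r - A) x‖² = r² ‖x‖² + ‖A x‖²` for real `r`, so `r - A` is boundedly invertible for
`r ≠ 0`. The approximations `Bₙ = n² A (n² - A²)⁻¹`, for `n` a positive integer, are bounded,
skew-adjoint, commute with each other and converge to `A` on `D(A)`
(`IsSkewAdjoint.exists_yosida`). The unitary groups
`exp (t Bₙ)` then converge strongly, because
`‖exp (t Bₘ) x - exp (t Bₙ) x‖ ≤ |t| ‖Bₘ x - Bₙ x‖`, and the limit inherits the group law, unitarity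
and a first-order Taylor estimate on `D(A)`. Thus the generator of the limit extends `A`; being
skew-symmetric, it equals `A`.
-/

/-! ### Skew-adjointness in terms of the graph -/

namespace Mori

section Graph

variable {H : Type*} [NormedAddCommGroup H] [InnerProductSpace ℂ H] [CompleteSpace H]
  {A : H →ₗ.[ℂ] H}

/-- Skew-adjointness in terms of the graph: `A` is skew-symmetric, and every pair that could be
added to its graph without destroying skew-symmetry against `A` already belongs to it. -/
theorem isSkewAdjoint_iff :
    IsSkewAdjoint A ↔ Dense (A.domain : Set H) ∧ ∀ x y, (x, y) ∈ A.graph ↔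
      ∀ u v, (u, v) ∈ A.graph → inner ℂ y u = -inner ℂ x v := by
  refine and_congr_right fun hd => ?_
  have hadj : ∀ x y, (x, y) ∈ A.adjoint.graph ↔
      ∀ u v, (u, v) ∈ A.graph → inner ℂ y u = inner ℂ x v := by
    intro x y
    rw [LinearPMap.adjoint_graph_eq_graph_adjoint hd, Submodule.mem_adjoint_iff]
    refine forall₃_congr fun u v _ => ?_
    rw [sub_eq_zero, ← inner_conj_symm v x, ← inner_conj_symm u y,
      (starRingEnd ℂ).injective.eq_iff, eq_comm]
  have hneg : ∀ x y, (x, y) ∈ (-A).graph ↔ (x, -y) ∈ A.graph := by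
    intro x y
    simp only [LinearPMap.mem_graph_iff, LinearPMap.neg_apply]
    exact exists_congr fun u => and_congr_right fun _ => neg_eq_iff_eq_neg
  constructor
  · intro h x y
    rw [← neg_neg y, ← hneg, ← h, hadj]
    simp only [neg_neg, inner_neg_left, neg_eq_iff_eq_neg]
  · intro h
    refine LinearPMap.eq_of_eq_graph ?_
    ext ⟨x, y⟩
    rw [hadj, hneg, h]
    simp only [inner_neg_left, neg_inj]

end Graph

end Mori

/-! ### The operators `QL` and `QLQ` -/

namespace Mori

variable {H : Type*} [NormedAddCommGroup H] [InnerProductSpace ℂ H]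

theorem mem_graph_leftMul {B : H →L[ℂ] H} {T : H →ₗ.[ℂ] H} {x y : H} :
    (x, y) ∈ (leftMul B T).graph ↔ ∃ w, (x, w) ∈ T.graph ∧ B w = y := by
  simp only [LinearPMap.mem_graph_iff]
  constructor
  · rintro ⟨u, rfl, rfl⟩
    exact ⟨T u, ⟨u, rfl, rfl⟩, rfl⟩
  · rintro ⟨_, ⟨u, rfl, rfl⟩, rfl⟩
    exact ⟨u, rfl, rfl⟩

theorem mem_graph_rightMul {B : H →L[ℂ] H} {T : H →ₗ.[ℂ] H} {x y : H} :
    (x, y) ∈ (rightMul T B).graph ↔ (B x, y) ∈ T.graph := by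
  simp only [LinearPMap.mem_graph_iff]
  constructor
  · rintro ⟨u, rfl, rfl⟩
    exact ⟨⟨B u, u.2⟩, rfl, rfl⟩
  · rintro ⟨u, hu, rfl⟩
    have hx : B x ∈ T.domain := hu ▸ u.2
    exact ⟨⟨x, hx⟩, rfl, congrArg T (Subtype.ext hu.symm)⟩

theorem projP_apply (z x : H) : projP z x = ((inner ℂ z z)⁻¹ * inner ℂ z x) • z := by
  simp [projP, smul_smul]

theorem projQ_apply (z x : H) : projQ z x = x - ((inner ℂ z z)⁻¹ * inner ℂ z x) • z := by
  simp [projQ, projP_apply]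

theorem projQ_self {z : H} (hz : z ≠ 0) : projQ z z = 0 := by
  rw [projQ_apply, inv_mul_cancel₀ (inner_self_ne_zero.2 hz), one_smul, sub_self]

theorem inner_projQ_left (z x y : H) : inner ℂ (projQ z x) y = inner ℂ x (projQ z y) := by
  simp only [projQ_apply, inner_sub_left, inner_sub_right, inner_smul_left, inner_smul_right,
    map_mul, map_inv₀, inner_conj_symm]
  ring

theorem _root_.LinearPMap.IsClosed.closure_eq {T : H →ₗ.[ℂ] H} (hT : T.IsClosed) :
    T.closure = T := by
  refine LinearPMap.eq_of_eq_graph ?_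
  rw [← hT.isClosable.graph_closure_eq_closure_graph]
  exact IsClosed.submodule_topologicalClosure_eq hT

theorem projQ_mem_domain_iff {L : H →ₗ.[ℂ] H} {z : H} (hz : z ∈ L.domain) {x : H} :
    projQ z x ∈ L.domain ↔ x ∈ L.domain := by
  rw [projQ_apply]
  exact L.domain.sub_mem_iff_left (L.domain.smul_mem _ hz)

variable [CompleteSpace H] {L : H →ₗ.[ℂ] H}

theorem IsSkewAdjoint.inner_eq_neg (hL : IsSkewAdjoint L) {x y u v : H} (hx : (x, y) ∈ L.graph)
    (hu : (u, v) ∈ L.graph) : inner ℂ y u = -inner ℂ x v :=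
  ((isSkewAdjoint_iff.1 hL).2 x y).1 hx u v hu

theorem IsSkewAdjoint.mem_graph (hL : IsSkewAdjoint L) {x y : H}
    (h : ∀ u v, (u, v) ∈ L.graph → inner ℂ y u = -inner ℂ x v) : (x, y) ∈ L.graph :=
  ((isSkewAdjoint_iff.1 hL).2 x y).2 h

theorem IsSkewAdjoint.isClosed (hL : IsSkewAdjoint L) : L.IsClosed := by
  have : (L.graph : Set (H × H)) =
      ⋂ p ∈ L.graph, {q : H × H | inner ℂ q.2 p.1 = -inner ℂ q.1 p.2} := by
    ext ⟨x, y⟩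
    simp only [SetLike.mem_coe, Set.mem_iInter, Set.mem_ofPred_eq, Prod.forall]
    exact ⟨fun h u v => hL.inner_eq_neg h, hL.mem_graph⟩
  rw [LinearPMap.IsClosed, this]
  exact isClosed_biInter fun p _ => isClosed_eq (by fun_prop) (by fun_prop)

/-- Since `z ∈ D(L)`, the operator `PL` is the restriction to `D(L)` of the bounded operator
`x ↦ -(x, Lz) (z, z)⁻¹ z`. So `QL` is a bounded perturbation of the closed operator `L`. -/
theorem IsSkewAdjoint.isClosed_leftMul_projQ (hL : IsSkewAdjoint L) {z : H} (hz : z ∈ L.domain) :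
    (leftMul (projQ z) L).IsClosed := by
  obtain ⟨z', hz'⟩ := LinearPMap.mem_domain_iff.1 hz
  have hmem : ∀ x y, (x, y) ∈ (leftMul (projQ z) L).graph ↔
      (x, y - ((inner ℂ z z)⁻¹ * inner ℂ z' x) • z) ∈ L.graph := by
    intro x y
    rw [mem_graph_leftMul]
    constructor
    · rintro ⟨w, hw, rfl⟩
      rw [hL.inner_eq_neg hz' hw, projQ_apply]
      simpa using hw
    · intro h
      refine ⟨_, h, ?_⟩
      have h2 := hL.inner_eq_neg hz' h
      rw [projQ_apply, ← neg_eq_iff_eq_neg.2 h2]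
      simp
  have : ((leftMul (projQ z) L).graph : Set (H × H)) =
      (fun q : H × H => (q.1, q.2 - ((inner ℂ z z)⁻¹ * inner ℂ z' q.1) • z)) ⁻¹' L.graph := by
    ext ⟨x, y⟩
    exact hmem x y
  rw [LinearPMap.IsClosed, this]
  exact IsClosed.preimage (by fun_prop) hL.isClosed

theorem IsSkewAdjoint.leftMul_rightMul_projQ (hL : IsSkewAdjoint L) {z : H} (hz : z ∈ L.domain)
    (hz0 : z ≠ 0) : IsSkewAdjoint (leftMul (projQ z) (rightMul L (projQ z))) := by
  have hdom : (leftMul (projQ z) (rightMul L (projQ z))).domain = L.domain := by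
    ext x
    exact projQ_mem_domain_iff hz
  have hgraph : ∀ x y, (x, y) ∈ (leftMul (projQ z) (rightMul L (projQ z))).graph ↔
      ∃ w, (projQ z x, w) ∈ L.graph ∧ projQ z w = y := by
    intro x y
    simp only [mem_graph_leftMul, mem_graph_rightMul]
  refine isSkewAdjoint_iff.2 ⟨by rw [hdom]; exact hL.1, fun x y => ?_⟩
  simp only [hgraph]
  constructor
  · rintro ⟨w, hw, rfl⟩ u _ ⟨v, hv, rfl⟩
    rw [inner_projQ_left, ← inner_projQ_left z x]
    exact hL.inner_eq_neg hw hv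
  · intro h
    obtain ⟨z', hz'⟩ := LinearPMap.mem_domain_iff.1 hz
    -- `QLQ z = 0`, so testing against `u = z` shows that `y` is orthogonal to `z`.
    have hyz : inner ℂ z y = 0 := by
      have := h z 0 ⟨0, by simp [projQ_self hz0], by simp⟩
      rw [inner_zero_right, neg_zero] at this
      rw [← inner_conj_symm, this, map_zero]
    -- For `u ∈ D(L)`, `LQu = Lu - c (z, u) Lz`; the last term is a bounded functional of `u`.
    refine ⟨y - ((inner ℂ z z)⁻¹ * inner ℂ z' (projQ z x)) • z, hL.mem_graph fun u v hu => ?_, ?_⟩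
    · have hQu : (projQ z u, v - ((inner ℂ z z)⁻¹ * inner ℂ z u) • z') ∈ L.graph := by
        rw [projQ_apply]
        exact L.graph.sub_mem hu (L.graph.smul_mem _ hz')
      have := h u _ ⟨_, hQu, rfl⟩
      rw [← inner_projQ_left] at this
      rw [inner_sub_left, this]
      simp only [inner_sub_right, inner_smul_right, inner_smul_left, map_mul, map_inv₀,
        inner_conj_symm]
      ring
    · rw [map_sub, map_smul, projQ_self hz0, smul_zero, sub_zero, projQ_apply, hyz]
      simp

end Mori

/-! ### Real resolvents of a skew-adjoint operator -/

namespace Mori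

variable {H : Type*} [NormedAddCommGroup H] [InnerProductSpace ℂ H]

/-- `R` is the resolvent `(r - A)⁻¹` of `A` at the real number `r`. The graph condition says that
`x ∈ D(A)` and `(r - A) x = y`, so the equivalence makes `R` a two-sided inverse. -/
def IsRealResolvent (A : H →ₗ.[ℂ] H) (r : ℝ) (R : H →L[ℂ] H) : Prop :=
  ∀ x y, (x, (r : ℂ) • x - y) ∈ A.graph ↔ R y = x

namespace IsRealResolvent

variable {A : H →ₗ.[ℂ] H} {r s : ℝ} {R S : H →L[ℂ] H}

theorem mem_graph (hR : IsRealResolvent A r R) (y : H) : (R y, (r : ℂ) • R y - y) ∈ A.graph :=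
  (hR _ _).2 rfl

theorem apply_sub (hR : IsRealResolvent A r R) {x w : H} (h : (x, w) ∈ A.graph) :
    (r : ℂ) • R x = x + R w := by
  have : R ((r : ℂ) • x - w) = x := (hR _ _).1 (by simpa using h)
  rw [map_sub, map_smul, sub_eq_iff_eq_add] at this
  exact this

theorem map_mem_graph (hR : IsRealResolvent A r R) {x w : H} (h : (x, w) ∈ A.graph) :
    (R x, R w) ∈ A.graph := by
  have := hR.mem_graph x
  rwa [hR.apply_sub h, add_sub_cancel_left] at this

theorem commute (hR : IsRealResolvent A r R) (hS : IsRealResolvent A s S) : Commute R S := by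
  ext y
  have := hR.map_mem_graph (hS.mem_graph y)
  rw [map_sub, map_smul] at this
  exact ((hS _ _).1 this).symm

end IsRealResolvent

variable [CompleteSpace H] {A : H →ₗ.[ℂ] H}

/-- The cross term vanishes because `(Ax, x)` is purely imaginary. -/
theorem IsSkewAdjoint.norm_smul_sub_sq (hA : IsSkewAdjoint A) {x w : H} (h : (x, w) ∈ A.graph)
    (r : ℝ) : ‖(r : ℂ) • x - w‖ ^ 2 = r ^ 2 * ‖x‖ ^ 2 + ‖w‖ ^ 2 := by
  have h0 : (inner ℂ x w).re = 0 := by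
    have h1 := congrArg Complex.re (hA.inner_eq_neg h h)
    rw [← inner_conj_symm, Complex.conj_re, Complex.neg_re] at h1
    linarith
  rw [@norm_sub_sq ℂ, inner_smul_left, norm_smul, Complex.conj_ofReal, RCLike.re_eq_complex_re,
    Complex.re_ofReal_mul, h0, mul_pow, Complex.norm_real, Real.norm_eq_abs, sq_abs]
  ring

theorem IsSkewAdjoint.abs_mul_norm_le (hA : IsSkewAdjoint A) {x w : H} (h : (x, w) ∈ A.graph)
    (r : ℝ) : |r| * ‖x‖ ≤ ‖(r : ℂ) • x - w‖ := by
  refine le_of_sq_le_sq ?_ (norm_nonneg _)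
  rw [hA.norm_smul_sub_sq h, mul_pow, sq_abs]
  exact le_add_of_nonneg_right (sq_nonneg _)

theorem IsSkewAdjoint.norm_le_norm_sub (hA : IsSkewAdjoint A) {x w : H} (h : (x, w) ∈ A.graph)
    (r : ℝ) : ‖w‖ ≤ ‖(r : ℂ) • x - w‖ := by
  refine le_of_sq_le_sq ?_ (norm_nonneg _)
  rw [hA.norm_smul_sub_sq h]
  exact le_add_of_nonneg_left (by positivity)

/-- The range of `r - A` is closed because `r - A` is bounded below and `A` is closed, and it is
dense because a vector orthogonal to it lies in the kernel of `r - A† = r + A`. -/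
theorem IsSkewAdjoint.exists_isRealResolvent (hA : IsSkewAdjoint A) {r : ℝ} (hr : r ≠ 0) :
    ∃ R, IsRealResolvent A r R := by
  have hr0 : 0 < |r| := abs_pos.2 hr
  have hrc : (r : ℂ) ≠ 0 := Complex.ofReal_ne_zero.2 hr
  have : CompleteSpace A.graph := hA.isClosed.completeSpace_coe
  -- `r - A`, viewed as a bounded operator on the graph of `A`
  let f : A.graph →L[ℂ] H :=
    ((r : ℂ) • ContinuousLinearMap.fst ℂ H H - ContinuousLinearMap.snd ℂ H H).comp A.graph.subtypeL
  have hf : ∀ p : A.graph, f p = (r : ℂ) • (p : H × H).1 - (p : H × H).2 := fun p => rfl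
  have h1 : ∀ p : A.graph, ‖(p : H × H).1‖ ≤ |r|⁻¹ * ‖f p‖ := fun p => by
    rw [inv_mul_eq_div, le_div_iff₀' hr0]
    exact hA.abs_mul_norm_le p.2 r
  have h2 : ∀ p : A.graph, ‖(p : H × H).2‖ ≤ ‖f p‖ := fun p => hA.norm_le_norm_sub p.2 r
  have hbound : ∀ p : A.graph, ‖p‖ ≤ (|r|⁻¹ + 1) * ‖f p‖ := fun p => by
    have : ‖p‖ = max ‖(p : H × H).1‖ ‖(p : H × H).2‖ := rfl
    rw [this, add_mul, one_mul]
    refine max_le ((h1 p).trans (le_add_of_nonneg_right (norm_nonneg _))) ((h2 p).trans ?_)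
    exact le_add_of_nonneg_left (by positivity)
  have hanti : AntilipschitzWith (Real.toNNReal (|r|⁻¹ + 1)) f :=
    AddMonoidHomClass.antilipschitz_of_bound f fun p => by
      rw [Real.coe_toNNReal _ (by positivity)]
      exact hbound p
  have hclosed : IsClosed (f.range : Set H) := hanti.isClosed_range f.uniformContinuous
  have hortho : f.rangeᗮ = ⊥ := by
    rw [Submodule.eq_bot_iff]
    intro y hy
    have hy' : (y, -(r : ℂ) • y) ∈ A.graph := hA.mem_graph fun u v hu => by
      have h := (Submodule.mem_orthogonal' _ _).1 hy (f ⟨(u, v), hu⟩) ⟨_, rfl⟩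
      rw [hf, inner_sub_right, inner_smul_right, sub_eq_zero] at h
      rw [inner_smul_left, ← h]
      simp
    have h := hA.abs_mul_norm_le hy' (-r)
    have h0 : ((-r : ℝ) : ℂ) • y - -(r : ℂ) • y = 0 := by simp
    rw [h0, norm_zero, abs_neg] at h
    exact norm_le_zero_iff.1 (nonpos_of_mul_nonpos_right h hr0)
  have hsurj : f.range = ⊤ := by
    have : CompleteSpace f.range := hclosed.completeSpace_coe
    exact Submodule.orthogonal_eq_bot_iff.1 hortho
  let e := ContinuousLinearEquiv.ofBijective f (LinearMap.ker_eq_bot.2 hanti.injective) hsurj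
  refine ⟨(ContinuousLinearMap.fst ℂ H H).comp (A.graph.subtypeL.comp (e.symm : H →L[ℂ] A.graph)),
    fun x y => ?_⟩
  constructor
  · intro h
    have : e ⟨_, h⟩ = y := by
      change (r : ℂ) • x - ((r : ℂ) • x - y) = y
      abel
    rw [← this]
    simp
  · rintro rfl
    have h : (r : ℂ) • (e.symm y : H × H).1 - (e.symm y : H × H).2 = y := e.apply_symm_apply y
    have h' := (e.symm y).2
    convert h' using 1
    refine Prod.ext rfl ?_
    change (r : ℂ) • (e.symm y : H × H).1 - y = _
    nth_rw 2 [← h]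
    abel

namespace IsRealResolvent

variable {r s : ℝ} {R S : H →L[ℂ] H}

theorem norm_apply_le (hA : IsSkewAdjoint A) (hR : IsRealResolvent A r R) (hr : r ≠ 0) (y : H) :
    ‖R y‖ ≤ |r|⁻¹ * ‖y‖ := by
  rw [inv_mul_eq_div, le_div_iff₀' (abs_pos.2 hr)]
  simpa using hA.abs_mul_norm_le (hR.mem_graph y) r

theorem inner_apply_left (hA : IsSkewAdjoint A) (hR : IsRealResolvent A r R)
    (hS : IsRealResolvent A (-r) S) (x y : H) : inner ℂ (R x) y = -inner ℂ x (S y) := by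
  have h := hA.inner_eq_neg (hR.mem_graph x) (hS.mem_graph y)
  simp only [inner_sub_left, inner_sub_right, inner_smul_left, inner_smul_right,
    Complex.conj_ofReal, Complex.ofReal_neg] at h
  linear_combination -h

end IsRealResolvent

end Mori

/-! ### Exponentials of bounded skew-adjoint operators -/

namespace Mori

variable {H : Type*} [NormedAddCommGroup H] [InnerProductSpace ℂ H] [CompleteSpace H]

section Exp

variable {B C : H →L[ℂ] H}

theorem exp_smul_mem_unitary (hB : B ∈ skewAdjoint (H →L[ℂ] H)) (t : ℝ) :
    NormedSpace.exp (t • B) ∈ unitary (H →L[ℂ] H) := by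
  let +nondep : NormedAlgebra ℚ (H →L[ℂ] H) := .restrictScalars ℚ ℂ _
  exact NormedSpace.exp_mem_unitary_of_mem_skewAdjoint (skewAdjoint.smul_mem t hB)

theorem exp_add_smul (B : H →L[ℂ] H) (s t : ℝ) :
    NormedSpace.exp ((s + t) • B) = NormedSpace.exp (s • B) * NormedSpace.exp (t • B) := by
  let +nondep : NormedAlgebra ℚ (H →L[ℂ] H) := .restrictScalars ℚ ℂ _
  rw [add_smul, NormedSpace.exp_add_of_commute]
  exact ((Commute.refl B).smul_left s).smul_right t

theorem norm_exp_smul_apply (hB : B ∈ skewAdjoint (H →L[ℂ] H)) (t : ℝ) (x : H) :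
    ‖NormedSpace.exp (t • B) x‖ = ‖x‖ :=
  ContinuousLinearMap.norm_map_of_mem_unitary (exp_smul_mem_unitary hB t) x

theorem hasDerivAt_exp_smul_apply (B : H →L[ℂ] H) (x : H) (t : ℝ) :
    HasDerivAt (fun s : ℝ => NormedSpace.exp (s • B) x) (NormedSpace.exp (t • B) (B x)) t :=
  ((ContinuousLinearMap.apply ℂ H x).restrictScalars ℝ).hasFDerivAt.comp_hasDerivAt t
    (hasDerivAt_exp_smul_const (𝕂 := ℝ) B t)

theorem norm_exp_smul_apply_sub_le (hB : B ∈ skewAdjoint (H →L[ℂ] H)) (t : ℝ) (x : H) :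
    ‖NormedSpace.exp (t • B) x - x‖ ≤ |t| * ‖B x‖ := by
  have h := Convex.norm_image_sub_le_of_norm_hasDerivWithin_le (s := Set.univ) (x := 0) (y := t)
    (fun s _ => (hasDerivAt_exp_smul_apply B x s).hasDerivWithinAt)
    (fun s _ => (norm_exp_smul_apply hB s (B x)).le) convex_univ trivial trivial
  simpa [mul_comm] using h

/-- A first-order Taylor estimate in which `‖B (B x)‖` is avoided: `B x` is only compared with a
vector `v`. This makes it uniform over approximations `B` of an unbounded operator. -/
theorem norm_exp_smul_apply_sub_sub_le (hB : B ∈ skewAdjoint (H →L[ℂ] H)) (t : ℝ) (x v : H) :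
    ‖NormedSpace.exp (t • B) x - x - t • B x‖ ≤ |t| * (2 * ‖B x - v‖ + |t| * ‖B v‖) := by
  have hder : ∀ s ∈ Set.uIcc 0 t, HasDerivWithinAt
      (fun s : ℝ => NormedSpace.exp (s • B) x - s • B x)
      (NormedSpace.exp (s • B) (B x) - B x) (Set.uIcc 0 t) s := fun s _ => by
    have := (hasDerivAt_exp_smul_apply B x s).sub ((hasDerivAt_id s).smul_const (B x))
    rw [one_smul] at this
    exact this.hasDerivWithinAt
  have hbound : ∀ s ∈ Set.uIcc 0 t,
      ‖NormedSpace.exp (s • B) (B x) - B x‖ ≤ 2 * ‖B x - v‖ + |t| * ‖B v‖ := fun s hs => by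
    have hst : |s| ≤ |t| := by simpa using Set.abs_sub_left_of_mem_uIcc hs
    have heq : NormedSpace.exp (s • B) (B x) - B x =
        NormedSpace.exp (s • B) (B x - v) - (B x - v) + (NormedSpace.exp (s • B) v - v) := by
      rw [map_sub]
      abel
    calc _ ≤ ‖NormedSpace.exp (s • B) (B x - v)‖ + ‖B x - v‖ +
          ‖NormedSpace.exp (s • B) v - v‖ := by
          rw [heq]
          exact (norm_add_le _ _).trans (add_le_add_left (norm_sub_le _ _) _)
      _ ≤ ‖B x - v‖ + ‖B x - v‖ + |t| * ‖B v‖ := by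
          rw [norm_exp_smul_apply hB]
          gcongr
          exact (norm_exp_smul_apply_sub_le hB s v).trans (by gcongr)
      _ = _ := by ring
  have h := Convex.norm_image_sub_le_of_norm_hasDerivWithin_le hder hbound (convex_uIcc 0 t)
    Set.left_mem_uIcc Set.right_mem_uIcc
  rw [zero_smul, zero_smul, NormedSpace.exp_zero, one_apply_eq_self, sub_zero,
    sub_zero, Real.norm_eq_abs, mul_comm, sub_right_comm] at h
  exact h

theorem norm_exp_smul_sub_exp_smul_le (hB : B ∈ skewAdjoint (H →L[ℂ] H))
    (hC : C ∈ skewAdjoint (H →L[ℂ] H)) (hBC : Commute B C) (t : ℝ) (x : H) :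
    ‖NormedSpace.exp (t • B) x - NormedSpace.exp (t • C) x‖ ≤ |t| * ‖B x - C x‖ := by
  let +nondep : NormedAlgebra ℚ (H →L[ℂ] H) := .restrictScalars ℚ ℂ _
  have h : NormedSpace.exp (t • B) = NormedSpace.exp (t • C) * NormedSpace.exp (t • (B - C)) := by
    rw [← NormedSpace.exp_add_of_commute]
    · rw [← smul_add, add_sub_cancel]
    · exact ((hBC.symm.sub_right (Commute.refl C)).smul_left t).smul_right t
  rw [h, mul_apply_eq_comp, ← map_sub, norm_exp_smul_apply hC]
  exact norm_exp_smul_apply_sub_le (sub_mem hB hC) t x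

end Exp

/-! ### Yosida approximation -/

section Yosida

variable {A : H →ₗ.[ℂ] H}

/-- The error of the approximation `r² A (r² - A²)⁻¹` of `A` at `x`, where `w = A x`, in terms of
any `u ∈ D(A)`, where `v = A u`: the second term is small for `|r|` large,
the first for `u` close to `w`. -/
theorem norm_yosida_sub_le (hA : IsSkewAdjoint A) {r : ℝ} (hr : r ≠ 0) {R S : H →L[ℂ] H}
    (hR : IsRealResolvent A r R) (hS : IsRealResolvent A (-r) S) {x w u v : H}
    (hx : (x, w) ∈ A.graph) (hu : (u, v) ∈ A.graph) :
    ‖((r : ℂ) ^ 2 / 2) • (R x + S x) - w‖ ≤ 2 * ‖w - u‖ + |r|⁻¹ * ‖v‖ := by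
  have hr0 : 0 < |r| := abs_pos.2 hr
  -- On `D(A)`, `B x = J (A x)` with `B = r²/2 • (R + S)` and the contraction `J = r/2 • (R - S)`.
  have e1 : ((r : ℂ) ^ 2 / 2) • (R x + S x) = ((r : ℂ) / 2) • (R w - S w) := by
    have h1 := hR.apply_sub hx
    have h2 := hS.apply_sub hx
    rw [Complex.ofReal_neg, neg_smul, neg_eq_iff_eq_neg] at h2
    rw [show (r : ℂ) ^ 2 / 2 = (r / 2) * r by ring, mul_smul, smul_add, h1, h2]
    congr 1
    abel
  have e2 : ((r : ℂ) / 2) • (R u - S u) = u + (2⁻¹ : ℂ) • (R v + S v) := by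
    have h1 := hR.apply_sub hu
    have h2 := hS.apply_sub hu
    rw [Complex.ofReal_neg, neg_smul, neg_eq_iff_eq_neg] at h2
    rw [show (r : ℂ) / 2 = 2⁻¹ * r by ring, mul_smul, smul_sub, h1, h2]
    module
  have e3 : ((r : ℂ) ^ 2 / 2) • (R x + S x) - w =
      ((r : ℂ) / 2) • (R (w - u) - S (w - u)) + (2⁻¹ : ℂ) • (R v + S v) - (w - u) := by
    rw [e1, map_sub, map_sub, sub_sub_sub_comm, smul_sub _ (R w - S w), e2]
    abel
  have hRb := fun y => IsRealResolvent.norm_apply_le hA hR hr y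
  have hSb : ∀ y, ‖S y‖ ≤ |r|⁻¹ * ‖y‖ := fun y => by
    simpa using IsRealResolvent.norm_apply_le hA hS (neg_ne_zero.2 hr) y
  have n1 : ‖((r : ℂ) / 2) • (R (w - u) - S (w - u))‖ ≤ ‖w - u‖ := by
    rw [norm_smul, norm_div, Complex.norm_real, Real.norm_eq_abs, Complex.norm_ofNat]
    calc _ ≤ |r| / 2 * (|r|⁻¹ * ‖w - u‖ + |r|⁻¹ * ‖w - u‖) := by
          gcongr
          exact (norm_sub_le _ _).trans (add_le_add (hRb _) (hSb _))
      _ = _ := by field_simp; ring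
  have n2 : ‖(2⁻¹ : ℂ) • (R v + S v)‖ ≤ |r|⁻¹ * ‖v‖ := by
    rw [norm_smul, norm_inv, Complex.norm_ofNat]
    calc _ ≤ 2⁻¹ * (|r|⁻¹ * ‖v‖ + |r|⁻¹ * ‖v‖) := by
          gcongr
          exact (norm_add_le _ _).trans (add_le_add (hRb _) (hSb _))
      _ = _ := by ring
  rw [e3]
  calc _ ≤ ‖w - u‖ + |r|⁻¹ * ‖v‖ + ‖w - u‖ :=
        (norm_sub_le _ _).trans (add_le_add_left ((norm_add_le _ _).trans (add_le_add n1 n2)) _)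
    _ = _ := by ring

/-- The symmetrized Yosida approximations `n² A (n² - A²)⁻¹`, written in terms of resolvents as
`n²/2 • ((n - A)⁻¹ + (-n - A)⁻¹)`: bounded, skew-adjoint, commuting, and convergent to `A` on
the domain of `A`. -/
theorem IsSkewAdjoint.exists_yosida (hA : IsSkewAdjoint A) :
    ∃ B : ℕ → H →L[ℂ] H, (∀ n, B n ∈ skewAdjoint (H →L[ℂ] H)) ∧ (∀ m n, Commute (B m) (B n)) ∧
      ∀ x w, (x, w) ∈ A.graph → Tendsto (fun n => B n x) atTop (𝓝 w) := by
  have hex : ∀ r : ℝ, ∃ R, r ≠ 0 → IsRealResolvent A r R := fun r => by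
    by_cases hr : r = 0
    · exact ⟨0, fun h => absurd hr h⟩
    · exact (hA.exists_isRealResolvent hr).imp fun _ h _ => h
  choose R hR using hex
  -- `n + 1` rather than `n`, since there is no resolvent at `0` in general
  let r : ℕ → ℝ := fun n => n + 1
  have hr : ∀ n, r n ≠ 0 := fun n => (Nat.cast_add_one_pos n).ne'
  have hR1 := fun n => hR (r n) (hr n)
  have hR2 := fun n => hR (-r n) (neg_ne_zero.2 (hr n))
  refine ⟨fun n => ((r n : ℂ) ^ 2 / 2) • (R (r n) + R (-r n)), fun n => ?_, fun m n => ?_,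
    fun x w hx => ?_⟩
  · have h1 : star (R (r n)) = -R (-r n) := by
      refine (ContinuousLinearMap.eq_adjoint_iff _ _).2 (fun x y => ?_) |>.symm
      have := IsRealResolvent.inner_apply_left hA (hR2 n) (by simpa using hR1 n) x y
      rw [neg_apply, inner_neg_left, this, neg_neg]
    have h2 : star (R (-r n)) = -R (r n) := by
      rw [← star_star (R (r n)), h1, star_neg, neg_neg]
    have h3 : star ((r n : ℂ) ^ 2 / 2) = (r n : ℂ) ^ 2 / 2 := by simp
    rw [skewAdjoint.mem_iff, star_smul, star_add, h1, h2, h3, ← neg_add, smul_neg, add_comm]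
  · refine Commute.smul_left (Commute.smul_right ?_ _) _
    exact (((hR1 m).commute (hR1 n)).add_right ((hR1 m).commute (hR2 n))).add_left
      (((hR2 m).commute (hR1 n)).add_right ((hR2 m).commute (hR2 n)))
  · rw [Metric.tendsto_atTop]
    intro ε hε
    obtain ⟨u, hu, hwu⟩ := hA.1.exists_dist_lt w (by positivity : 0 < ε / 4)
    obtain ⟨v, hv⟩ := LinearPMap.mem_domain_iff.1 hu
    obtain ⟨N, hN⟩ := exists_nat_gt (2 * ‖v‖ / ε)
    refine ⟨N, fun n hn => ?_⟩
    have h := norm_yosida_sub_le hA (hr n) (hR1 n) (hR2 n) hx hv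
    have hrn : 0 < r n := Nat.cast_add_one_pos n
    have hrN : 2 * ‖v‖ / ε < r n := hN.trans (by
      have : (N : ℝ) ≤ n := by exact_mod_cast hn
      exact this.trans_lt (lt_add_one _))
    have h1 : |r n|⁻¹ * ‖v‖ < ε / 2 := by
      rw [abs_of_pos hrn, inv_mul_lt_iff₀ hrn]
      rw [div_lt_iff₀ hε] at hrN
      linarith
    rw [dist_eq_norm] at hwu ⊢
    exact h.trans_lt (by linarith)

end Yosida

end Mori

/-! ### Generation of the unitary group -/

namespace Mori

variable {H : Type*} [NormedAddCommGroup H] [InnerProductSpace ℂ H] [CompleteSpace H]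

/-- Unitary groups of commuting bounded generators converge pointwise as soon as the generators
converge on a dense subspace. -/
theorem cauchySeq_exp_smul_apply {B : ℕ → H →L[ℂ] H}
    (hB : ∀ n, B n ∈ skewAdjoint (H →L[ℂ] H)) (hcomm : ∀ m n, Commute (B m) (B n))
    {D : Set H} (hD : Dense D) (hconv : ∀ x ∈ D, CauchySeq fun n => B n x) (t : ℝ) (x : H) :
    CauchySeq fun n => NormedSpace.exp (t • B n) x := by
  rw [Metric.cauchySeq_iff]
  intro ε hε
  obtain ⟨y, hy, hxy⟩ := hD.exists_dist_lt x (by positivity : 0 < ε / 4)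
  have ht : 0 < |t| + 1 := by positivity
  obtain ⟨N, hN⟩ := Metric.cauchySeq_iff.1 (hconv y hy) (ε / 2 / (|t| + 1)) (by positivity)
  refine ⟨N, fun m hm n hn => ?_⟩
  have h1 := norm_exp_smul_sub_exp_smul_le (hB m) (hB n) (hcomm m n) t y
  have h2 := hN m hm n hn
  rw [dist_eq_norm] at h2 hxy ⊢
  rw [lt_div_iff₀' ht] at h2
  -- `y ∈ D` approximates `x`, and both exponentials act isometrically on `x - y`.
  have heq : NormedSpace.exp (t • B m) x - NormedSpace.exp (t • B n) x =
      NormedSpace.exp (t • B m) (x - y) - NormedSpace.exp (t • B n) (x - y) +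
        (NormedSpace.exp (t • B m) y - NormedSpace.exp (t • B n) y) := by
    rw [map_sub, map_sub]
    abel
  have h3 : ‖NormedSpace.exp (t • B m) (x - y) - NormedSpace.exp (t • B n) (x - y)‖ ≤
      ‖x - y‖ + ‖x - y‖ := by
    refine (norm_sub_le _ _).trans_eq ?_
    rw [norm_exp_smul_apply (hB m), norm_exp_smul_apply (hB n)]
  have h4 : |t| * ‖B m y - B n y‖ ≤ (|t| + 1) * ‖B m y - B n y‖ := by
    gcongr
    exact le_add_of_nonneg_right zero_le_one
  rw [heq]
  linarith [norm_add_le (NormedSpace.exp (t • B m) (x - y) - NormedSpace.exp (t • B n) (x - y))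
    (NormedSpace.exp (t • B m) y - NormedSpace.exp (t • B n) y)]

theorem IsUnitaryGroup.inner_apply_left {G : ℝ → H →L[ℂ] H} (hG : IsUnitaryGroup G) (t : ℝ)
    (x y : H) : inner ℂ (G t x) y = inner ℂ x (G (-t) y) := by
  have h : G t (G (-t) y) = y := by
    rw [← mul_apply_eq_comp, ← hG.map_add, add_neg_cancel, hG.map_zero, one_apply_eq_self]
  nth_rw 1 [← h]
  exact ContinuousLinearMap.inner_map_map_of_mem_unitary (hG.mem_unitary t) _ _

/-- The generator of a unitary group is skew-symmetric, so it cannot properly extend a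
skew-adjoint operator. -/
theorem IsSkewAdjoint.isGenerator_of_tendsto {A : H →ₗ.[ℂ] H} (hA : IsSkewAdjoint A)
    {G : ℝ → H →L[ℂ] H} (hG : IsUnitaryGroup G)
    (h : ∀ x y, (x, y) ∈ A.graph →
      Tendsto (fun h : ℝ => (h : ℂ)⁻¹ • (G h x - x)) (𝓝[≠] 0) (𝓝 y)) :
    IsGenerator A G := by
  refine fun x y => ⟨h x y, fun hxy => hA.mem_graph fun u v huv => ?_⟩
  have h1 : Tendsto (fun s : ℝ => inner ℂ ((s : ℂ)⁻¹ • (G s x - x)) u) (𝓝[≠] 0)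
      (𝓝 (inner ℂ y u)) := hxy.inner tendsto_const_nhds
  have hneg : Tendsto (fun s : ℝ => -s) (𝓝[≠] 0) (𝓝[≠] 0) := by
    refine tendsto_nhdsWithin_iff.2 ⟨?_, ?_⟩
    · exact (continuous_neg.tendsto' (0 : ℝ) 0 neg_zero).mono_left nhdsWithin_le_nhds
    · filter_upwards [self_mem_nhdsWithin] with s hs
      exact neg_ne_zero.2 hs
  have h2 : Tendsto (fun s : ℝ => -inner ℂ x (((-s : ℝ) : ℂ)⁻¹ • (G (-s) u - u))) (𝓝[≠] 0)
      (𝓝 (-inner ℂ x v)) := (tendsto_const_nhds.inner ((h u v huv).comp hneg)).neg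
  refine tendsto_nhds_unique h1 (h2.congr fun s => ?_)
  simp only [inner_smul_left, inner_smul_right, inner_sub_left, inner_sub_right,
    hG.inner_apply_left, map_inv₀, Complex.conj_ofReal, Complex.ofReal_neg, inv_neg]
  ring

/-- The generation half of Stone's theorem: the group is the strong limit of the groups
`exp (t Bₙ)` of the Yosida approximations. -/
theorem IsSkewAdjoint.exists_isUnitaryGroup {A : H →ₗ.[ℂ] H} (hA : IsSkewAdjoint A) :
    ∃ G : ℝ → H →L[ℂ] H, IsUnitaryGroup G ∧ IsGenerator A G := by
  obtain ⟨B, hB, hcomm, hconv⟩ := hA.exists_yosida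
  have hlim : ∀ t x, ∃ y, Tendsto (fun n => NormedSpace.exp (t • B n) x) atTop (𝓝 y) := fun t x =>
    cauchySeq_tendsto_of_complete <| cauchySeq_exp_smul_apply hB hcomm hA.1 (fun y hy => by
      obtain ⟨w, hw⟩ := LinearPMap.mem_domain_iff.1 hy
      exact (hconv y w hw).cauchySeq) t x
  choose g hg using hlim
  obtain ⟨G, hG⟩ : ∃ G : ℝ → H →L[ℂ] H, ∀ t x,
      Tendsto (fun n => NormedSpace.exp (t • B n) x) atTop (𝓝 (G t x)) :=
    ⟨fun t => continuousLinearMapOfTendsto (fun n => NormedSpace.exp (t • B n))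
      (tendsto_pi_nhds.2 (hg t)), hg⟩
  have hnorm : ∀ t x, ‖G t x‖ = ‖x‖ := fun t x =>
    tendsto_nhds_unique (hG t x).norm (by
      simp only [norm_exp_smul_apply (hB _)]
      exact tendsto_const_nhds)
  have hzero : G 0 = 1 := by
    ext x
    refine tendsto_nhds_unique (hG 0 x) ?_
    simp only [zero_smul, NormedSpace.exp_zero]
    exact tendsto_const_nhds
  have hadd : ∀ s t, G (s + t) = G s * G t := fun s t => by
    ext x
    refine tendsto_nhds_unique (hG (s + t) x) ?_
    have h1 : Tendsto (fun n => NormedSpace.exp (s • B n) (NormedSpace.exp (t • B n) x - G t x))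
        atTop (𝓝 0) := by
      refine tendsto_zero_iff_norm_tendsto_zero.2 ?_
      simp only [norm_exp_smul_apply (hB _)]
      exact tendsto_iff_norm_sub_tendsto_zero.1 (hG t x)
    have h2 := h1.add (hG s (G t x))
    rw [zero_add] at h2
    refine h2.congr fun n => ?_
    rw [← map_add, sub_add_cancel, exp_add_smul, mul_apply_eq_comp]
  have hinv : ∀ t, G t * G (-t) = 1 := fun t => by rw [← hadd, add_neg_cancel, hzero]
  have hunit : ∀ t, G t ∈ unitary (H →L[ℂ] H) := fun t => by
    have hiso : star (G t) * G t = 1 :=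
      (ContinuousLinearMap.norm_map_iff_adjoint_comp_self _).1 (hnorm t)
    have hstar : star (G t) = G (-t) := by
      rw [← mul_one (star (G t)), ← hinv t, ← mul_assoc, hiso, one_mul]
    rw [Unitary.mem_iff]
    exact ⟨hiso, by rw [hstar, hinv]⟩
  have hlip : ∀ t x w, (x, w) ∈ A.graph → ‖G t x - x‖ ≤ |t| * ‖w‖ := fun t x w hx =>
    le_of_tendsto_of_tendsto' ((hG t x).sub_const x).norm ((hconv x w hx).norm.const_mul |t|)
      fun n => norm_exp_smul_apply_sub_le (hB n) t x
  have htaylor : ∀ t x w u v, (x, w) ∈ A.graph → (u, v) ∈ A.graph →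
      ‖G t x - x - t • w‖ ≤ |t| * (2 * ‖w - u‖ + |t| * ‖v‖) := fun t x w u v hx hu =>
    le_of_tendsto_of_tendsto' (((hG t x).sub_const x).sub ((hconv x w hx).const_smul t)).norm
      (((((hconv x w hx).sub_const u).norm.const_mul 2).add
        ((hconv u v hu).norm.const_mul |t|)).const_mul |t|)
      fun n => norm_exp_smul_apply_sub_sub_le (hB n) t x u
  -- An orbit starting in `D(A)` is Lipschitz; `D(A)` is dense and every `G t` is isometric.
  have hcont : ∀ x, Continuous fun t => G t x := fun x => by
    refine Metric.continuous_iff.2 fun s ε hε => ?_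
    obtain ⟨y, hy, hxy⟩ := hA.1.exists_dist_lt x (by positivity : 0 < ε / 4)
    obtain ⟨w, hw⟩ := LinearPMap.mem_domain_iff.1 hy
    have hw1 : 0 < ‖w‖ + 1 := by positivity
    refine ⟨ε / 2 / (‖w‖ + 1), by positivity, fun t ht => ?_⟩
    rw [dist_eq_norm] at hxy ⊢
    rw [Real.dist_eq, lt_div_iff₀ hw1] at ht
    have heq : G t x - G s x = G s (G (t - s) (x - y) - (x - y) + (G (t - s) y - y)) := by
      rw [map_sub (G (t - s)), sub_sub_sub_comm, sub_add_cancel, map_sub, ← mul_apply_eq_comp,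
        ← hadd, add_sub_cancel]
    have h1 : ‖G (t - s) (x - y) - (x - y)‖ ≤ ‖x - y‖ + ‖x - y‖ :=
      (norm_sub_le _ _).trans_eq (by rw [hnorm])
    have h2 := hlip (t - s) y w hw
    rw [heq, hnorm]
    linarith [norm_add_le (G (t - s) (x - y) - (x - y)) (G (t - s) y - y), abs_nonneg (t - s)]
  have hgroup : IsUnitaryGroup G := ⟨hzero, hadd, hcont, hunit⟩
  refine ⟨G, hgroup, hA.isGenerator_of_tendsto hgroup fun x w hx => ?_⟩
  refine Metric.tendsto_nhdsWithin_nhds.2 fun ε hε => ?_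
  obtain ⟨u, hu, hwu⟩ := hA.1.exists_dist_lt w (by positivity : 0 < ε / 4)
  obtain ⟨v, hv⟩ := LinearPMap.mem_domain_iff.1 hu
  have hv1 : 0 < ‖v‖ + 1 := by positivity
  refine ⟨ε / 2 / (‖v‖ + 1), by positivity, fun t ht0 ht => ?_⟩
  have ht0' : 0 < |t| := abs_pos.2 ht0
  have htc : (t : ℂ) ≠ 0 := Complex.ofReal_ne_zero.2 ht0
  rw [Real.dist_eq, sub_zero, lt_div_iff₀ hv1] at ht
  rw [dist_eq_norm] at hwu ⊢
  have heq : (t : ℂ)⁻¹ • (G t x - x) - w = (t : ℂ)⁻¹ • (G t x - x - t • w) := by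
    rw [smul_sub _ _ (t • w), ← Complex.coe_smul, inv_smul_smul₀ htc]
  have h1 := htaylor t x w u v hx hv
  rw [heq, norm_smul, norm_inv, Complex.norm_real, Real.norm_eq_abs, inv_mul_lt_iff₀ ht0']
  refine h1.trans_lt (mul_lt_mul_of_pos_left ?_ ht0')
  linarith

end Mori

/-! ### The unitary group generated by `QLQ` -/

theorem mainTheorem9 {H : Type*} [NormedAddCommGroup H] [InnerProductSpace ℂ H] [CompleteSpace H]
    (L : H →ₗ.[ℂ] H) (hL : Mori.IsSkewAdjoint L) (z : H) (hz : z ∈ L.domain) (hz0 : z ≠ 0) :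
    (Mori.leftMul (Mori.projQ z) L).IsClosable ∧
    Mori.rightMul (Mori.leftMul (Mori.projQ z) L).closure (Mori.projQ z) =
      Mori.leftMul (Mori.projQ z) (Mori.rightMul L (Mori.projQ z)) ∧
    Mori.IsSkewAdjoint
      (Mori.rightMul (Mori.leftMul (Mori.projQ z) L).closure (Mori.projQ z)) ∧
    ∃ G : ℝ → H →L[ℂ] H, Mori.IsUnitaryGroup G ∧
      Mori.IsGenerator
        (Mori.rightMul (Mori.leftMul (Mori.projQ z) L).closure (Mori.projQ z)) G := by
  have hclosed := hL.isClosed_leftMul_projQ hz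
  have heq : Mori.rightMul (Mori.leftMul (Mori.projQ z) L).closure (Mori.projQ z) =
      Mori.leftMul (Mori.projQ z) (Mori.rightMul L (Mori.projQ z)) := by
    rw [hclosed.closure_eq]
    refine LinearPMap.eq_of_eq_graph ?_
    ext ⟨x, y⟩
    simp only [Mori.mem_graph_leftMul, Mori.mem_graph_rightMul]
  have hskew := hL.leftMul_rightMul_projQ hz hz0
  rw [← heq] at hskew
  exact ⟨hclosed.isClosable, heq, hskew, hskew.exists_isUnitaryGroup⟩
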